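/- **Definitions.** Let $G$ be a finitely generated group. A finite generating set $S$ of $G$ gives the word metric $d_S$, that is, the path metric on the vertices of the Cayley graph $\Gamma(G,S)$ (with edges joining $x$ and $xs$, $s\in S$). Paths are finite sequences $\gamma=(\gamma_0,\dots,\gamma_n)$ of vertices; $\gamma$ is a *geodesic* if $d(\gamma_i,\gamma_j)=|i-j|$ for all $i,j$, and, for $K\ge 1$, $\epsilon\ge 0$, a *$(K,\epsilon)$-quasigeodesic* if $\frac1K|i-j|-\epsilon\le d(\gamma_i,\gamma_j)\le K|i-j|+\epsilon$ for all $i,j$. For a function $f:\mathbb R_{\ge1}\times\mathbb R_{\ge0}\to\mathbb R_{\ge0}$, a quasigeodesic $\gamma$ is *$f$-stable* if for all $K\ge1$, $\epsilon\ge0$ every $(K,\epsilon)$-quasigeodesic with both endpoints on $\gamma$ is contained in the $f(K,\epsilon)$-neighbourhood of $\gamma$. A subgroup $H\le G$ is *stable* if it is finitely generated and, for some (equivalently, all) finite generating sets $T$ of $H$ and $S$ of $G$, the inclusion $(H,d_T)\to(G,d_S)$ is a quasi-isometric embedding and there is one function $f$ such that the image in $G$ of every geodesic of $H$ is an $f$-stable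 quasigeodesic. For $H\le G$ and $g\in G$ write $H^g=gHg^{-1}$. Let $\mathcal H=(H_1,\dots,H_l)$ be a finite family of subgroups of $G$. Below, cosets are left cosets $gH_i$ regarded as subsets of $G$. * $\mathcal H$ has *finite height* if there is $n\ge 0$ such that $H_{\sigma(0)}^{g_0}\cap\dots\cap H_{\sigma(n)}^{g_n}$ is finite for all $g_j\in G$ and $\sigma(j)\in\{1,\dots,l\}$ ($0\le j\le n$) for which the $n+1$ cosets $g_jH_{\sigma(j)}$ are distinct. * $\mathcal H$ has *finite width* if there is $n\ge0$ such that every collection of distinct cosets $g_1H_{\sigma(1)},\dots,g_kH_{\sigma(k)}$ with $H_{\sigma(i)}^{g_i}\cap H_{\sigma(j)}^{g_j}$ infinite for all $i,j\in\{1,\dots,k\}$ satisfies $k\le n$. * $\mathcal H$ has *bounded packing* with respect to a finite generating set $S$ of $G$ if for every $D\ge0$ there is $N\in\mathbb N$ such that among any $N$ distinct cosets $g_1H_{\sigma(1)},\dots,g_NH_{\sigma(N)}$ there are two whose distance $\inf\{d_S(x,y)\}$ ($x$ in the one, $y$ in the other) is at least $D$. **Theorem.** Let $H_1,\dots,H_l$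 be stable subgroups of a finitely generated group $G$. Then the family $\mathcal H=(H_1,\dots,H_l)$ has finite height, has finite width, and has bounded packing with respect to every finite generating set of $G$. -/

import Mathlib

namespace StableSubgroups

/-! Graphs are regarded as metric spaces with the path metric `SimpleGraph.dist` on vertices.
Finite paths are parametrised by the integer interval `{0, …, n}`: a path of length `n` is given by
a function on `ℕ`, of which only the values at `0, …, n` matter. -/

/-- `γ 0, …, γ n` is a geodesic of length `n`. -/
def IsGeodesic {V : Type*} (Γ : SimpleGraph V) (n : ℕ) (γ : ℕ → V) : Prop :=
  ∀ i j : ℕ, i ≤ j → j ≤ n → Γ.dist (γ i) (γ j) = j - i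

/-- `η 0, …, η n` is a `(K, ε)`-quasigeodesic. It need not be an edge path. -/
def IsQuasigeodesic {V : Type*} (Γ : SimpleGraph V) (K ε : ℝ) (n : ℕ) (η : ℕ → V) : Prop :=
  ∀ i j : ℕ, i ≤ n → j ≤ n →
    K⁻¹ * |(i : ℝ) - j| - ε ≤ Γ.dist (η i) (η j) ∧ (Γ.dist (η i) (η j) : ℝ) ≤ K * |(i : ℝ) - j| + ε

/-- The path `γ 0, …, γ n` is `f`-stable: every `(K, ε)`-quasigeodesic (`1 ≤ K`, `0 ≤ ε`) with
both endpoints on it lies in its `f K ε`-neighbourhood. Only the values of `f` at such `K`, `ε`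
matter, and they are then automatically nonnegative. -/
def IsStablePath {V : Type*} (Γ : SimpleGraph V) (f : ℝ → ℝ → ℝ) (n : ℕ) (γ : ℕ → V) : Prop :=
  ∀ K ε : ℝ, 1 ≤ K → 0 ≤ ε → ∀ (m : ℕ) (η : ℕ → V), IsQuasigeodesic Γ K ε m η →
    (∃ i ≤ n, η 0 = γ i) → (∃ i ≤ n, η m = γ i) →
    ∀ j ≤ m, ∃ i ≤ n, (Γ.dist (η j) (γ i) : ℝ) ≤ f K ε

/-- `Φ` is a quasi-isometric embedding. -/
def IsQIEmbedding {V W : Type*} (Γ : SimpleGraph V) (Δ : SimpleGraph W) (Φ : V → W) : Prop :=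
  ∃ K ε : ℝ, 1 ≤ K ∧ 0 ≤ ε ∧ ∀ x y : V,
    K⁻¹ * Γ.dist x y - ε ≤ Δ.dist (Φ x) (Φ y) ∧ (Δ.dist (Φ x) (Φ y) : ℝ) ≤ K * Γ.dist x y + ε

/-- `Φ` is a stable embedding: a quasi-isometric embedding such that the images of all geodesics
(which are therefore quasigeodesics) are stable with one common stability function. -/
def IsStableEmbedding {V W : Type*} (Γ : SimpleGraph V) (Δ : SimpleGraph W) (Φ : V → W) : Prop :=
  IsQIEmbedding Γ Δ Φ ∧
    ∃ f : ℝ → ℝ → ℝ, ∀ (n : ℕ) (γ : ℕ → V), IsGeodesic Γ n γ →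
      IsStablePath Δ f n (fun i => Φ (γ i))

/-- `S` is a finite generating set of the group `G`. -/
def IsFiniteGenSet {G : Type*} [Group G] (S : Set G) : Prop :=
  S.Finite ∧ Subgroup.closure S = ⊤

/-- `H` is a stable subgroup of `G`: for some finite generating sets `T` of `H` and `S` of `G`
(equivalently, for all of them), the inclusion of `H` into `G` is a stable embedding with respect
to the word metrics, that is, the path metrics of the Cayley graphs. -/
def IsStable {G : Type*} [Group G] (H : Subgroup G) : Prop :=
  ∃ (T : Set H) (S : Set G), IsFiniteGenSet T ∧ IsFiniteGenSet S ∧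
    IsStableEmbedding (SimpleGraph.mulCayley T) (SimpleGraph.mulCayley S) (fun h : H => (h : G))

/-- The left coset `gH`, as a subset of `G`. -/
def leftCoset {G : Type*} [Group G] (g : G) (H : Subgroup G) : Set G :=
  {x | ∃ h ∈ H, x = g * h}

/-- The conjugate `H^g = g H g⁻¹`. -/
def conjugate {G : Type*} [Group G] (H : Subgroup G) (g : G) : Subgroup G :=
  H.map (MulAut.conj g).toMonoidHom

/-- The family `H 1, …, H l` has height at most `n`: the intersection of any `n + 1` essentially
distinct conjugates is finite. -/
def HeightAtMost {G : Type*} [Group G] {l : ℕ} (H : Fin l → Subgroup G) (n : ℕ) : Prop :=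
  ∀ (σ : Fin (n + 1) → Fin l) (g : Fin (n + 1) → G),
    Function.Injective (fun j => leftCoset (g j) (H (σ j))) →
    Finite (⨅ j, conjugate (H (σ j)) (g j) : Subgroup G)

/-- The family `H 1, …, H l` has width at most `n`: any collection of distinct left cosets of
the members, such that any two of the corresponding conjugates intersect in an infinite subgroup,
has at most `n` elements. (It suffices to consider finite collections; a single coset counts only
if the corresponding conjugate is infinite.) -/
def WidthAtMost {G : Type*} [Group G] {l : ℕ} (H : Fin l → Subgroup G) (n : ℕ) : Prop :=
  ∀ (k : ℕ) (σ : Fin k → Fin l) (g : Fin k → G),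
    Function.Injective (fun j => leftCoset (g j) (H (σ j))) →
    (∀ i j, Infinite (conjugate (H (σ i)) (g i) ⊓ conjugate (H (σ j)) (g j) : Subgroup G)) →
    k ≤ n

/-- The family `H 1, …, H l` has bounded packing with respect to the word metric of `S`: for each
`D ≥ 0` there is `N` such that among any `N` distinct left cosets of the members at least two are
at distance (the infimum of the distances of their points) at least `D`. -/
def HasBoundedPacking {G : Type*} [Group G] (S : Set G) {l : ℕ} (H : Fin l → Subgroup G) : Prop :=
  ∀ D : ℝ, 0 ≤ D → ∃ N : ℕ, ∀ (σ : Fin N → Fin l) (g : Fin N → G),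
    Function.Injective (fun j => leftCoset (g j) (H (σ j))) →
    ∃ i j, i ≠ j ∧ ∀ x ∈ leftCoset (g i) (H (σ i)), ∀ y ∈ leftCoset (g j) (H (σ j)),
      D ≤ (SimpleGraph.mulCayley S).dist x y

end StableSubgroups

/-!
The proof rests on a Helly property of stable embeddings (`exists_forall_dist_le`): if the images of
finitely many uniformly stable embeddings into a graph are pairwise `D`-close, then some point is
close to all of them, with a constant that does not depend on their number. All cosets of the
subgroups are images of uniformly stable embeddings, and only boundedly many cosets meet a given
ball, so only boundedly many cosets are pairwise `D`-close. This is bounded packing.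

The only construction of quasigeodesics is `exists_isQuasigeodesic_of_nearest`: a geodesic from a
point `z` to a nearest point of a quasigeodesic, followed by the quasigeodesic, is again a
quasigeodesic. For the Helly property, fix one of the embeddings, with domain `V`, and a basepoint
`z` in its image `A`. For two other images `B₁`, `B₂`, the projection to a path in `A` of a point
where `B₁` and `B₂` come close is a point of `A` that is close to both. A geodesic of `V` from `z`
to this point passes close to the points of `B₁` and `B₂` nearest to `z`, and it follows `Bᵢ` from
there on. Hence, among the nearest points to `z`, one that is farthest from `z` is close to all the
images. Distances from `z` are compared inside `V`, along whose geodesics they determine the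
parameter up to a bounded error.

For the width, let the conjugates that belong to two cosets have infinite intersection. A long
element of the intersection gives two far apart points of the first coset, each nearest to a point
of the second. The path between these points of the second coset through the first one is a
quasigeodesic with uniform constants, so the cosets are uniformly close
(`exists_dist_le_of_infinite_inf`), and bounded packing bounds their number. The height is at most
the width, since an infinite common intersection makes all pairwise intersections infinite.
-/

namespace StableSubgroups

variable {V W : Type*} {Γ : SimpleGraph V} {Δ : SimpleGraph W}

theorem dist_triangle_real (hΔ : Δ.Connected) (a b c : W) :
    (Δ.dist a c : ℝ) ≤ Δ.dist a b + Δ.dist b c := by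
  exact_mod_cast hΔ.dist_triangle

theorem dist_comm_real (a b : W) : (Δ.dist a b : ℝ) = Δ.dist b a := by
  rw [SimpleGraph.dist_comm]

/-! ### Geodesics and quasigeodesics -/

theorem exists_isGeodesic (hΓ : Γ.Connected) (x y : V) :
    ∃ γ : ℕ → V, γ 0 = x ∧ γ (Γ.dist x y) = y ∧ IsGeodesic Γ (Γ.dist x y) γ := by
  obtain ⟨p, hp⟩ := hΓ.exists_walk_length_eq_dist x y
  refine ⟨p.getVert, p.getVert_zero, by rw [← hp, p.getVert_length], ?_⟩
  have step : ∀ i k : ℕ, Γ.dist (p.getVert i) (p.getVert (i + k)) ≤ k := by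
    intro i k
    induction k with
    | zero => simp
    | succ k ih =>
      refine hΓ.dist_triangle (v := p.getVert (i + k)) |>.trans (Nat.add_le_add ih ?_)
      rcases lt_or_ge (i + k) p.length with h | h
      · exact (SimpleGraph.dist_eq_one_iff_adj.mpr (p.adj_getVert_succ h)).le
      · rw [p.getVert_of_length_le h, p.getVert_of_length_le (i := i + (k + 1)) (by omega)]
        simp
  intro i j hij hj
  have h0 := step 0 i
  have h1 := step i (j - i)
  have h2 := step j (p.length - j)
  rw [Nat.zero_add, p.getVert_zero] at h0
  rw [Nat.add_sub_cancel' hij] at h1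
  rw [Nat.add_sub_cancel' (hj.trans hp.ge), p.getVert_length] at h2
  have h3 := hΓ.dist_triangle (u := x) (v := p.getVert i) (w := p.getVert j)
  have h4 := hΓ.dist_triangle (u := x) (v := p.getVert j) (w := y)
  omega

theorem isQuasigeodesic_iff {K ε : ℝ} (hK : 1 ≤ K) {n : ℕ} {η : ℕ → W} :
    IsQuasigeodesic Δ K ε n η ↔ ∀ i j : ℕ, i ≤ j → j ≤ n →
      ((j : ℝ) - i ≤ K * (Δ.dist (η i) (η j) + ε) ∧
        (Δ.dist (η i) (η j) : ℝ) ≤ K * ((j : ℝ) - i) + ε) := by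
  have hK0 : 0 < K := by linarith
  have key : ∀ x d : ℝ, K⁻¹ * x - ε ≤ d ↔ x ≤ K * (d + ε) := fun x d => by
    rw [sub_le_iff_le_add, inv_mul_le_iff₀ hK0]
  constructor
  · intro h i j hij hj
    have := h i j (hij.trans hj) hj
    have hij' : (i : ℝ) ≤ j := by exact_mod_cast hij
    rwa [key, abs_sub_comm, abs_of_nonneg (by linarith)] at this
  · intro h i j hi hj
    rw [key]
    rcases le_total i j with hij | hij
    · have hij' : (i : ℝ) ≤ j := by exact_mod_cast hij
      rw [abs_sub_comm, abs_of_nonneg (by linarith)]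
      exact h i j hij hj
    · have hij' : (j : ℝ) ≤ i := by exact_mod_cast hij
      rw [abs_of_nonneg (by linarith), SimpleGraph.dist_comm]
      exact h j i hij hi

theorem IsQuasigeodesic.take {K ε : ℝ} {n m : ℕ} {η : ℕ → W} (h : IsQuasigeodesic Δ K ε n η)
    (hm : m ≤ n) : IsQuasigeodesic Δ K ε m η :=
  fun i j hi hj => h i j (hi.trans hm) (hj.trans hm)

theorem IsQuasigeodesic.drop {K ε : ℝ} {n m : ℕ} {η : ℕ → W} (h : IsQuasigeodesic Δ K ε n η)
    (hm : m ≤ n) : IsQuasigeodesic Δ K ε (n - m) (fun i => η (m + i)) := by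
  intro i j hi hj
  simpa using h (m + i) (m + j) (by omega) (by omega)

theorem IsQuasigeodesic.reverse {K ε : ℝ} {n : ℕ} {η : ℕ → W} (h : IsQuasigeodesic Δ K ε n η) :
    IsQuasigeodesic Δ K ε n (fun i => η (n - i)) := by
  intro i j hi hj
  have := h (n - i) (n - j) (by omega) (by omega)
  rw [Nat.cast_sub hi, Nat.cast_sub hj] at this
  rwa [show ((n : ℝ) - i - (n - j)) = j - i by ring, abs_sub_comm] at this

/-- A geodesic from `z` to a nearest point of a quasigeodesic `γ`, followed by `γ`, is a
quasigeodesic, provided that the nearest point is the initial point of `γ`. -/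
theorem exists_isQuasigeodesic_of_nearest (hΔ : Δ.Connected) {K ε : ℝ} (hK : 1 ≤ K) (hε : 0 ≤ ε)
    {n : ℕ} {γ : ℕ → W} (hγ : IsQuasigeodesic Δ K ε n γ) (z : W)
    (hz : ∀ i ≤ n, Δ.dist z (γ 0) ≤ Δ.dist z (γ i)) :
    ∃ (m : ℕ) (η : ℕ → W), IsQuasigeodesic Δ (3 * K) ε m η ∧ η 0 = z ∧ η m = γ n ∧
      (∀ i ≤ n, ∃ j ≤ m, η j = γ i) ∧
      ∀ j ≤ m, (∃ i ≤ n, η j = γ i) ∨ Δ.dist (η j) (γ 0) ≤ Δ.dist z (γ 0) := by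
  obtain ⟨δ, hδ0, hδ1, hδ⟩ := exists_isGeodesic hΔ z (γ 0)
  set r := Δ.dist z (γ 0) with hr
  set η : ℕ → W := fun i => if i ≤ r then δ i else γ (i - r) with hη
  have ηδ : ∀ i ≤ r, η i = δ i := fun i hi => by simp [hη, hi]
  have ηγ : ∀ i, r ≤ i → η i = γ (i - r) := by
    intro i hi
    rcases hi.eq_or_lt with rfl | hi
    · simp [hη, hδ1]
    · simp [hη, not_le.mpr hi]
  refine ⟨r + n, η, ?_, ?_, ?_, ?_, ?_⟩
  · rw [isQuasigeodesic_iff (by linarith)]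
    rw [isQuasigeodesic_iff hK] at hγ
    intro i j hij hj
    have hij' : (i : ℝ) ≤ j := by exact_mod_cast hij
    rcases le_total j r with hjr | hjr
    · -- Both points lie on the geodesic.
      rw [ηδ i (hij.trans hjr), ηδ j hjr, hδ i j hij hjr, Nat.cast_sub hij]
      constructor <;> nlinarith
    rcases le_total r i with hir | hir
    · -- Both points lie on `γ`.
      rw [ηγ i hir, ηγ j hjr]
      have := hγ (i - r) (j - r) (by omega) (by omega)
      rw [Nat.cast_sub hir, Nat.cast_sub hjr] at this
      have h0 : (0 : ℝ) ≤ Δ.dist (γ (i - r)) (γ (j - r)) := Nat.cast_nonneg _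
      have h1 : 0 ≤ K * (Δ.dist (γ (i - r)) (γ (j - r)) + ε) := by positivity
      have h2 : 0 ≤ K * ((j : ℝ) - i) := by apply mul_nonneg <;> linarith
      constructor <;> linarith
    · -- `γ 0` is also nearest to the point `δ i`, which gives `r - i ≤ d` and hence `e ≤ 2 * d`.
      rw [ηδ i hir, ηγ j hjr]
      have h1 := hδ 0 i (Nat.zero_le _) hir
      have h2 := hδ i r hir le_rfl
      rw [hδ0, Nat.sub_zero] at h1
      rw [hδ1] at h2
      have h3 := hγ 0 (j - r) (Nat.zero_le _) (by omega)
      have h4 := hz (j - r) (by omega)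
      have h5 := hΔ.dist_triangle (u := z) (v := δ i) (w := γ (j - r))
      have h6 := dist_triangle_real hΔ (γ 0) (δ i) (γ (j - r))
      have h7 := dist_triangle_real hΔ (δ i) (γ 0) (γ (j - r))
      rw [dist_comm_real (γ 0) (δ i)] at h6
      have h8 : r - i ≤ Δ.dist (δ i) (γ (j - r)) := by omega
      have h9 : (Δ.dist (δ i) (γ 0) : ℝ) = r - i := by rw [h2, Nat.cast_sub hir]
      have h10 : (r : ℝ) - i ≤ Δ.dist (δ i) (γ (j - r)) := by
        rw [← Nat.cast_sub hir]; exact Nat.cast_le.mpr h8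
      rw [Nat.cast_sub hjr] at h3
      obtain ⟨h3, h3'⟩ := h3
      have hir' : (i : ℝ) ≤ r := by exact_mod_cast hir
      have hjr' : (r : ℝ) ≤ j := by exact_mod_cast hjr
      set d : ℝ := ((Δ.dist (δ i) (γ (j - r)) : ℕ) : ℝ)
      set e : ℝ := ((Δ.dist (γ 0) (γ (j - r)) : ℕ) : ℝ)
      have hd : 0 ≤ d := by linarith
      push_cast at h3 h3'
      constructor
      · have : K * (e + ε) ≤ K * (2 * d + ε) := by gcongr; linarith
        nlinarith
      · nlinarith
  · rw [ηδ 0 (Nat.zero_le _), hδ0]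
  · rw [ηγ _ (Nat.le_add_right _ _), Nat.add_sub_cancel_left]
  · intro i hi
    exact ⟨r + i, by omega, by rw [ηγ _ (Nat.le_add_right _ _), Nat.add_sub_cancel_left]⟩
  · intro j hj
    rcases le_total j r with hjr | hjr
    · right
      have := hδ j r hjr le_rfl
      rw [hδ1] at this
      rw [ηδ j hjr]
      omega
    · exact Or.inl ⟨j - r, by omega, ηγ j hjr⟩

/-- Stability, for quasigeodesics whose endpoints are only close to the stable path. -/
theorem IsStablePath.exists_dist_le (hΔ : Δ.Connected) {f : ℝ → ℝ → ℝ} {n : ℕ} {γ : ℕ → W}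
    (hγ : IsStablePath Δ f n γ) {K ε D : ℝ} (hK : 1 ≤ K) (hε : 0 ≤ ε) (hD : 0 ≤ D)
    {m : ℕ} {η : ℕ → W} (hη : IsQuasigeodesic Δ K ε m η)
    (h0 : ∃ i ≤ n, (Δ.dist (η 0) (γ i) : ℝ) ≤ D) (h1 : ∃ i ≤ n, (Δ.dist (η m) (γ i) : ℝ) ≤ D)
    {j : ℕ} (hj : j ≤ m) :
    ∃ i ≤ n, (Δ.dist (η j) (γ i) : ℝ) ≤ f K (ε + 2 * D) + D := by
  obtain ⟨i₀, hi₀, h0⟩ := h0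
  obtain ⟨i₁, hi₁, h1⟩ := h1
  -- Quasigeodesics need not be edge paths, so the endpoints can simply be moved onto `γ`.
  set ζ : ℕ → W := fun k => if k = 0 then γ i₀ else if k = m then γ i₁ else η k with hζ
  have close : ∀ k, (Δ.dist (ζ k) (η k) : ℝ) ≤ D := by
    intro k
    by_cases hk : k = 0
    · subst hk; rw [dist_comm_real]; simpa [hζ] using h0
    by_cases hk' : k = m
    · subst hk'; rw [dist_comm_real]; simpa [hζ, hk] using h1
    · simpa [hζ, hk, hk'] using hD
  have hζq : IsQuasigeodesic Δ K (ε + 2 * D) m ζ := by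
    intro i k hi hk
    have h2 := hη i k hi hk
    have h3 := dist_triangle_real hΔ (ζ i) (η i) (ζ k)
    have h4 := dist_triangle_real hΔ (η i) (η k) (ζ k)
    have h5 := dist_triangle_real hΔ (η i) (ζ i) (η k)
    have h6 := dist_triangle_real hΔ (ζ i) (ζ k) (η k)
    rw [dist_comm_real (η k)] at h4
    rw [dist_comm_real (η i) (ζ i)] at h5
    have := close i
    have := close k
    constructor <;> linarith
  have hm : ∃ i ≤ n, ζ m = γ i := by
    by_cases hm : m = 0
    · exact ⟨i₀, hi₀, by simp [hζ, hm]⟩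
    · exact ⟨i₁, hi₁, by simp [hζ, hm]⟩
  obtain ⟨i, hi, h⟩ := hγ K _ hK (by linarith) m ζ hζq ⟨i₀, hi₀, by simp [hζ]⟩ hm j hj
  refine ⟨i, hi, ?_⟩
  have h3 := dist_triangle_real hΔ (η j) (ζ j) (γ i)
  rw [dist_comm_real (η j) (ζ j)] at h3
  linarith [close j]

/-! ### Uniformly stable embeddings -/

/-- A stable embedding with prescribed quasi-isometry constants `Λ`, `E` and stability function
`f`. The lower quasi-isometry bound is written without division, as `d ≤ Λ (d' + E)`. -/
structure IsUniformlyStable (Γ : SimpleGraph V) (Δ : SimpleGraph W) (Φ : V → W) (Λ E : ℝ)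
    (f : ℝ → ℝ → ℝ) : Prop where
  le_dist : ∀ x y : V, (Γ.dist x y : ℝ) ≤ Λ * (Δ.dist (Φ x) (Φ y) + E)
  dist_le : ∀ x y : V, (Δ.dist (Φ x) (Φ y) : ℝ) ≤ Λ * Γ.dist x y + E
  stable : ∀ (n : ℕ) (γ : ℕ → V), IsGeodesic Γ n γ → IsStablePath Δ f n (fun i => Φ (γ i))

namespace IsUniformlyStable

variable {Φ : V → W} {Λ E : ℝ} {f : ℝ → ℝ → ℝ}

theorem isQuasigeodesic (h : IsUniformlyStable Γ Δ Φ Λ E f) (hΛ : 1 ≤ Λ) {n : ℕ} {γ : ℕ → V}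
    (hγ : IsGeodesic Γ n γ) : IsQuasigeodesic Δ Λ E n (fun i => Φ (γ i)) := by
  rw [isQuasigeodesic_iff hΛ]
  intro i j hij hj
  rw [← Nat.cast_sub hij, ← hγ i j hij hj]
  exact ⟨h.le_dist _ _, h.dist_le _ _⟩

/-- The image of a stable embedding is quasiconvex with respect to quasigeodesics. -/
theorem exists_dist_le (h : IsUniformlyStable Γ Δ Φ Λ E f) (hΓ : Γ.Connected) (hΔ : Δ.Connected)
    {K ε D : ℝ} (hK : 1 ≤ K) (hε : 0 ≤ ε) (hD : 0 ≤ D) {m : ℕ} {η : ℕ → W}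
    (hη : IsQuasigeodesic Δ K ε m η) (h0 : ∃ v, (Δ.dist (η 0) (Φ v) : ℝ) ≤ D)
    (h1 : ∃ v, (Δ.dist (η m) (Φ v) : ℝ) ≤ D) {j : ℕ} (hj : j ≤ m) :
    ∃ v, (Δ.dist (η j) (Φ v) : ℝ) ≤ f K (ε + 2 * D) + D := by
  obtain ⟨v, hv⟩ := h0
  obtain ⟨w, hw⟩ := h1
  obtain ⟨γ, rfl, hγ1, hγ⟩ := exists_isGeodesic hΓ v w
  obtain ⟨i, -, hi⟩ := (h.stable _ _ hγ).exists_dist_le hΔ hK hε hD hη ⟨0, Nat.zero_le _, hv⟩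
    ⟨_, le_rfl, by rwa [hγ1]⟩ hj
  exact ⟨_, hi⟩

theorem mono (h : IsUniformlyStable Γ Δ Φ Λ E f) (hΛ : 0 ≤ Λ) (hE : 0 ≤ E) {Λ' E' : ℝ}
    {f' : ℝ → ℝ → ℝ} (hΛ' : Λ ≤ Λ') (hE' : E ≤ E') (hf : ∀ K ε, f K ε ≤ f' K ε) :
    IsUniformlyStable Γ Δ Φ Λ' E' f' where
  le_dist x y := (h.le_dist x y).trans (by have := hΛ.trans hΛ'; gcongr)
  dist_le x y := (h.dist_le x y).trans (by gcongr)
  stable n γ hγ K ε hK hε m η hη h0 h1 j hj := by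
    obtain ⟨i, hi, hd⟩ := h.stable n γ hγ K ε hK hε m η hη h0 h1 j hj
    exact ⟨i, hi, hd.trans (hf K ε)⟩

end IsUniformlyStable

/-! ### The Helly property -/

section Helly

variable {Λ E : ℝ} {f : ℝ → ℝ → ℝ}

/-- The closeness given by stability for a path consisting of a geodesic and the image of a geodesic
under a stable embedding, a `(3 Λ, E)`-quasigeodesic whose endpoints are `D`-close to a stable path
or to the image of a stable embedding. -/
def closeConst (Λ E : ℝ) (f : ℝ → ℝ → ℝ) (D : ℝ) : ℝ := f (3 * Λ) (E + 2 * D) + D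

/-- If the images of three stable embeddings are pairwise close, then some point of the first
image is close to the other two: project a point where the second and the third image are close
to a path in the first one. -/
theorem exists_dist_le_of_pairwise (hΔ : Δ.Connected) (hΛ : 1 ≤ Λ) (hE : 0 ≤ E) {D : ℝ}
    (hD : 0 ≤ D) {V₁ V₂ : Type*} {Γ₁ : SimpleGraph V₁} {Γ₂ : SimpleGraph V₂} (hΓ : Γ.Connected)
    (hΓ₁ : Γ₁.Connected) (hΓ₂ : Γ₂.Connected) {Φ : V → W} {Φ₁ : V₁ → W} {Φ₂ : V₂ → W}
    (h : IsUniformlyStable Γ Δ Φ Λ E f) (h₁ : IsUniformlyStable Γ₁ Δ Φ₁ Λ E f)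
    (h₂ : IsUniformlyStable Γ₂ Δ Φ₂ Λ E f)
    (h01 : ∃ v w, (Δ.dist (Φ v) (Φ₁ w) : ℝ) ≤ D) (h02 : ∃ v w, (Δ.dist (Φ v) (Φ₂ w) : ℝ) ≤ D)
    (h12 : ∃ v w, (Δ.dist (Φ₁ v) (Φ₂ w) : ℝ) ≤ D) :
    ∃ c, (∃ v, (Δ.dist (Φ c) (Φ₁ v) : ℝ) ≤ closeConst Λ E f D) ∧
      ∃ v, (Δ.dist (Φ c) (Φ₂ v) : ℝ) ≤ closeConst Λ E f D := by
  obtain ⟨p₁, q₁, hpq₁⟩ := h01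
  obtain ⟨p₂, q₂, hpq₂⟩ := h02
  obtain ⟨a₁, a₂, ha⟩ := h12
  obtain ⟨γ, hγ0, hγ1, hγ⟩ := exists_isGeodesic hΓ p₁ p₂
  set n := Γ.dist p₁ p₂
  obtain ⟨m, hm, hmin⟩ := Finset.exists_min_image (Finset.range (n + 1))
    (fun i => Δ.dist (Φ₁ a₁) (Φ (γ i))) ⟨0, by simp⟩
  have hm : m ≤ n := by simpa [Nat.lt_succ_iff] using hm
  have hmin : ∀ i ≤ n, Δ.dist (Φ₁ a₁) (Φ (γ m)) ≤ Δ.dist (Φ₁ a₁) (Φ (γ i)) :=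
    fun i hi => hmin i (by simpa [Nat.lt_succ_iff] using hi)
  have hq := h.isQuasigeodesic hΛ hγ
  have hΛ3 : 1 ≤ 3 * Λ := by linarith
  refine ⟨γ m, ?_, ?_⟩
  · obtain ⟨k, η, hη, hη0, hη1, hηγ, -⟩ := exists_isQuasigeodesic_of_nearest hΔ hΛ hE
      (hq.take hm).reverse (Φ₁ a₁) (fun i _ => hmin (m - i) (by omega))
    obtain ⟨j, hj, hηj⟩ := hηγ 0 (Nat.zero_le _)
    obtain ⟨v, hv⟩ := h₁.exists_dist_le hΓ₁ hΔ hΛ3 hE hD hη ⟨a₁, by simpa [hη0] using hD⟩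
      ⟨q₁, by simpa [hη1, hγ0] using hpq₁⟩ hj
    exact ⟨v, by simpa [closeConst, hηj] using hv⟩
  · obtain ⟨k, η, hη, hη0, hη1, hηγ, -⟩ := exists_isQuasigeodesic_of_nearest hΔ hΛ hE
      (hq.drop hm) (Φ₁ a₁) (fun i hi => hmin (m + i) (by omega))
    obtain ⟨j, hj, hηj⟩ := hηγ 0 (Nat.zero_le _)
    obtain ⟨v, hv⟩ := h₂.exists_dist_le hΓ₂ hΔ hΛ3 hE hD hη ⟨a₂, by simpa [hη0] using ha⟩
      ⟨q₂, by simpa [hη1, Nat.add_sub_cancel' hm, hγ1] using hpq₂⟩ hj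
    exact ⟨v, by simpa [closeConst, hηj] using hv⟩

/-- Let `Φ₁ w` be a point of the image of `Φ₁` nearest to the initial point of the image of a
geodesic `γ` under `Φ`. If the image of `Φ₁` comes close to the end of this path, then the path
passes close to `Φ₁ w`. -/
theorem exists_dist_le_of_nearest (hΔ : Δ.Connected) (hΛ : 1 ≤ Λ) (hE : 0 ≤ E) {D : ℝ}
    (hD : 0 ≤ D) {V₁ : Type*} {Γ₁ : SimpleGraph V₁} (hΓ₁ : Γ₁.Connected)
    {Φ : V → W} {Φ₁ : V₁ → W}
    (h : IsUniformlyStable Γ Δ Φ Λ E f) (h₁ : IsUniformlyStable Γ₁ Δ Φ₁ Λ E f)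
    {n : ℕ} {γ : ℕ → V} (hγ : IsGeodesic Γ n γ) {w : V₁}
    (hw : ∀ v, Δ.dist (Φ (γ 0)) (Φ₁ w) ≤ Δ.dist (Φ (γ 0)) (Φ₁ v))
    (hend : ∃ v, (Δ.dist (Φ (γ n)) (Φ₁ v) : ℝ) ≤ D) :
    ∃ t ≤ n, (Δ.dist (Φ₁ w) (Φ (γ t)) : ℝ) ≤ closeConst Λ E f D := by
  obtain ⟨v, hv⟩ := hend
  obtain ⟨β, hβ0, hβ1, hβ⟩ := exists_isGeodesic hΓ₁ w v
  obtain ⟨k, η, hη, hη0, hη1, hηγ, -⟩ := exists_isQuasigeodesic_of_nearest hΔ hΛ hE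
    (h₁.isQuasigeodesic hΛ hβ) (Φ (γ 0)) (fun i _ => by simpa [hβ0] using hw (β i))
  obtain ⟨j, hj, hηj⟩ := hηγ 0 (Nat.zero_le _)
  obtain ⟨t, ht, htd⟩ := (h.stable n γ hγ).exists_dist_le hΔ (by linarith) hE hD hη
    ⟨0, Nat.zero_le _, by simpa [hη0] using hD⟩
    ⟨n, le_rfl, by rw [hη1, hβ1, dist_comm_real]; exact hv⟩ hj
  exact ⟨t, ht, by simpa [closeConst, hηj, hβ0] using htd⟩

/-- The constant of the Helly property `exists_forall_dist_le` for pairwise `D`-close images of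
stable embeddings. -/
def hellyConst (Λ E : ℝ) (f : ℝ → ℝ → ℝ) (D : ℝ) : ℝ :=
  let C := closeConst Λ E f (closeConst Λ E f D)
  f Λ (E + 2 * C) + 2 * C + Λ * (2 * (Λ * (2 * C + E))) + E

/-- Helly property: if the images of finitely many stable embeddings are pairwise close, then
some point is close to all of them, at a distance that does not depend on their number. -/
theorem exists_forall_dist_le (hΔ : Δ.Connected) (hΛ : 1 ≤ Λ) (hE : 0 ≤ E)
    (hf : ∀ K ε, 0 ≤ f K ε) {D : ℝ} (hD : 0 ≤ D) {ι : Type*} [Finite ι] [Nonempty ι]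
    {V : ι → Type*} {Γ : ∀ i, SimpleGraph (V i)} (hΓ : ∀ i, (Γ i).Connected) {Φ : ∀ i, V i → W}
    (h : ∀ i, IsUniformlyStable (Γ i) Δ (Φ i) Λ E f)
    (hclose : ∀ i j, ∃ v w, (Δ.dist (Φ i v) (Φ j w) : ℝ) ≤ D) :
    ∃ p, ∀ j, ∃ v, (Δ.dist p (Φ j v) : ℝ) ≤ hellyConst Λ E f D := by
  obtain ⟨o⟩ := ‹Nonempty ι›
  obtain ⟨z, -⟩ := hclose o o
  set C₁ := closeConst Λ E f D with hC₁
  set C := closeConst Λ E f C₁ with hC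
  have hDC₁ : D ≤ C₁ := by rw [hC₁, closeConst]; linarith [hf (3 * Λ) (E + 2 * D)]
  have hC₁C : C₁ ≤ C := by rw [hC, closeConst]; linarith [hf (3 * Λ) (E + 2 * C₁)]
  have hC0 : 0 ≤ C := by linarith
  have hnear : ∀ i, ∃ x : V i, ∀ v, Δ.dist (Φ o z) (Φ i x) ≤ Δ.dist (Φ o z) (Φ i v) := by
    intro i
    have := (hΓ i).nonempty
    exact ⟨Function.argmin (fun v => Δ.dist (Φ o z) (Φ i v)),
      fun v => Function.argmin_le (fun v => Δ.dist (Φ o z) (Φ i v)) v⟩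
  choose x hx using hnear
  -- For each pair of indices, a geodesic from `z` to a point close to both images passes close to
  -- both nearest points.
  have hpair : ∀ i j, ∃ (n : ℕ) (γ : ℕ → V o), IsGeodesic (Γ o) n γ ∧ γ 0 = z ∧
      (∃ v, (Δ.dist (Φ o (γ n)) (Φ j v) : ℝ) ≤ C₁) ∧
      (∃ t ≤ n, (Δ.dist (Φ i (x i)) (Φ o (γ t)) : ℝ) ≤ C) ∧
      (∃ t ≤ n, (Δ.dist (Φ j (x j)) (Φ o (γ t)) : ℝ) ≤ C) := by
    intro i j
    obtain ⟨c, hci, hcj⟩ := exists_dist_le_of_pairwise hΔ hΛ hE hD (hΓ o) (hΓ i) (hΓ j) (h o)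
      (h i) (h j) (hclose o i) (hclose o j) (hclose i j)
    obtain ⟨γ, rfl, hγ1, hγ⟩ := exists_isGeodesic (hΓ o) z c
    refine ⟨_, γ, hγ, rfl, ?_, ?_, ?_⟩
    · rw [hγ1]; exact hcj
    · exact exists_dist_le_of_nearest hΔ hΛ hE (hD.trans hDC₁) (hΓ i) (h o) (h i) hγ (hx i)
        (by rw [hγ1]; exact hci)
    · exact exists_dist_le_of_nearest hΔ hΛ hE (hD.trans hDC₁) (hΓ j) (h o) (h j) hγ (hx j)
        (by rw [hγ1]; exact hcj)
  have hu : ∀ i, ∃ u : V o, (Δ.dist (Φ i (x i)) (Φ o u) : ℝ) ≤ C := by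
    intro i
    obtain ⟨n, γ, -, -, -, ⟨t, -, ht⟩, -⟩ := hpair i i
    exact ⟨_, ht⟩
  choose u hu using hu
  -- The wanted point is the nearest point that is farthest from `z`, as measured inside `V o`.
  obtain ⟨i, hi⟩ := Finite.exists_max (fun i => (Γ o).dist z (u i))
  -- Points of `V o` whose images are close to the same nearest point are close to each other.
  have hudist : ∀ k (v : V o), (Δ.dist (Φ k (x k)) (Φ o v) : ℝ) ≤ C →
      ((Γ o).dist (u k) v : ℝ) ≤ Λ * (2 * C + E) := by
    intro k v hv
    refine ((h o).le_dist _ _).trans ?_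
    have h1 := dist_triangle_real hΔ (Φ o (u k)) (Φ k (x k)) (Φ o v)
    rw [dist_comm_real (Φ o (u k)) (Φ k (x k))] at h1
    have h2 := hu k
    gcongr
    linarith
  refine ⟨Φ i (x i), fun j => ?_⟩
  obtain ⟨n, γ, hγ, hγ0, ⟨c, hc⟩, ⟨s, hs, hsd⟩, ⟨t, ht, htd⟩⟩ := hpair i j
  have hfC := hf Λ (E + 2 * C)
  have hp : 0 ≤ Λ * (2 * (Λ * (2 * C + E))) := by positivity
  simp only [hellyConst, ← hC₁, ← hC]
  rcases le_total t s with hts | hst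
  · -- Beyond `t` the path follows the image of `Φ j`, so at `s` it is close to it.
    obtain ⟨v, hv⟩ := (h j).exists_dist_le (hΓ j) hΔ hΛ hE hC0
      (((h o).isQuasigeodesic hΛ hγ).drop ht)
      ⟨x j, by rw [dist_comm_real]; exact htd⟩
      ⟨c, by rw [Nat.add_sub_cancel' ht]; exact hc.trans hC₁C⟩ (j := s - t) (by omega)
    rw [Nat.add_sub_cancel' hts] at hv
    have h1 := dist_triangle_real hΔ (Φ i (x i)) (Φ o (γ s)) (Φ j v)
    exact ⟨v, by linarith⟩
  · -- By maximality of `i`, the parameters `s` and `t` differ by a bounded amount only.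
    have h1 := hudist i _ hsd
    have h2 := hudist j _ htd
    have h3 := dist_triangle_real (hΓ o) z (γ s) (u i)
    have h4 := dist_triangle_real (hΓ o) z (u j) (γ t)
    rw [dist_comm_real (γ s)] at h3
    have h5 : ((Γ o).dist z (u j) : ℝ) ≤ (Γ o).dist z (u i) := by exact_mod_cast hi j
    have hzs : (Γ o).dist z (γ s) = s := by rw [← hγ0]; exact hγ 0 s (Nat.zero_le _) hs
    have hzt : (Γ o).dist z (γ t) = t := by rw [← hγ0]; exact hγ 0 t (Nat.zero_le _) ht
    rw [hzs] at h3
    rw [hzt] at h4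
    have h6 : ((Γ o).dist (γ s) (γ t) : ℝ) ≤ 2 * (Λ * (2 * C + E)) := by
      rw [hγ s t hst ht, Nat.cast_sub hst]
      linarith
    have h7 : Λ * ((Γ o).dist (γ s) (γ t) : ℝ) ≤ Λ * (2 * (Λ * (2 * C + E))) := by gcongr
    have h8 := (h o).dist_le (γ s) (γ t)
    have h9 := dist_triangle_real hΔ (Φ i (x i)) (Φ o (γ s)) (Φ j (x j))
    have h10 := dist_triangle_real hΔ (Φ o (γ s)) (Φ o (γ t)) (Φ j (x j))
    rw [dist_comm_real (Φ o (γ t)) (Φ j (x j))] at h10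
    exact ⟨x j, by linarith⟩

/-- If the image of `Φ₁` contains two points that are much farther from each other than from the
image of `Φ₂`, then the two images come uniformly close. -/
theorem exists_dist_le_of_long (hΔ : Δ.Connected) (hΛ : 1 ≤ Λ) (hE : 0 ≤ E)
    {V₁ V₂ : Type*} {Γ₁ : SimpleGraph V₁} {Γ₂ : SimpleGraph V₂}
    (hΓ₁ : Γ₁.Connected) (hΓ₂ : Γ₂.Connected) {Φ₁ : V₁ → W} {Φ₂ : V₂ → W}
    (h₁ : IsUniformlyStable Γ₁ Δ Φ₁ Λ E f) (h₂ : IsUniformlyStable Γ₂ Δ Φ₂ Λ E f)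
    {x x' : V₁} {y y' : V₂} {R : ℕ}
    (hx : ∀ v, Δ.dist (Φ₂ y) (Φ₁ x) ≤ Δ.dist (Φ₂ y) (Φ₁ v))
    (hx' : ∀ v, Δ.dist (Φ₂ y') (Φ₁ x') ≤ Δ.dist (Φ₂ y') (Φ₁ v))
    (hR : Δ.dist (Φ₂ y) (Φ₁ x) ≤ R) (hR' : Δ.dist (Φ₂ y') (Φ₁ x') ≤ R)
    (hlong : 3 * R ≤ Δ.dist (Φ₁ x) (Φ₁ x')) :
    ∃ v, (Δ.dist (Φ₁ x) (Φ₂ v) : ℝ) ≤ f (9 * Λ) E := by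
  obtain ⟨γ, hγ0, hγ1, hγ⟩ := exists_isGeodesic hΓ₁ x' x
  obtain ⟨m, η, hη, hη0, hη1, -, hηγ⟩ := exists_isQuasigeodesic_of_nearest hΔ hΛ hE
    (h₁.isQuasigeodesic hΛ hγ) (Φ₂ y') (fun i _ => by simpa [hγ0] using hx' (γ i))
  simp only [hγ0, hγ1] at hη1 hηγ
  -- `Φ₁ x` is nearest to `Φ₂ y` on the whole path `η`: its part outside the image of `Φ₁` stays
  -- within `R` of `Φ₁ x'`.
  obtain ⟨k, ζ, hζ, hζ0, hζ1, hζη, -⟩ := exists_isQuasigeodesic_of_nearest hΔ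
    (by linarith : 1 ≤ 3 * Λ) hE hη.reverse (Φ₂ y) (by
      intro i hi
      simp only [Nat.sub_zero, hη1]
      rcases hηγ (m - i) (by omega) with ⟨l, -, hl⟩ | hl
      · rw [hl]; exact hx _
      · have h1 := hΔ.dist_triangle (u := Φ₁ x) (v := Φ₂ y) (w := Φ₁ x')
        have h2 := hΔ.dist_triangle (u := Φ₂ y) (v := η (m - i)) (w := Φ₁ x')
        rw [SimpleGraph.dist_comm (u := Φ₁ x) (v := Φ₂ y)] at h1
        omega)
  simp only [Nat.sub_self, hη0] at hζ1
  obtain ⟨j, hj, hζj⟩ := hζη 0 (Nat.zero_le _)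
  rw [← mul_assoc] at hζ
  obtain ⟨v, hv⟩ := h₂.exists_dist_le hΓ₂ hΔ (by linarith) hE le_rfl hζ
    ⟨y, by simp [hζ0]⟩ ⟨y', by simp [hζ1]⟩ hj
  rw [hζj, Nat.sub_zero, hη1] at hv
  exact ⟨v, by norm_num at hv; exact hv⟩

end Helly

/-! ### Word metrics -/

section WordMetric

variable {G : Type*} [Group G] {S S' : Set G}

theorem reachable_mulCayley_mul_left (g : G) {a b : G}
    (h : (SimpleGraph.mulCayley S).Reachable a b) :
    (SimpleGraph.mulCayley S).Reachable (g * a) (g * b) :=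
  h.map (⟨(g * ·), fun h => SimpleGraph.mulCayley_adj_mul_iff_right.mpr h⟩ :
    SimpleGraph.mulCayley S →g SimpleGraph.mulCayley S)

theorem connected_mulCayley (hS : Subgroup.closure S = ⊤) :
    (SimpleGraph.mulCayley S).Connected := by
  have key : ∀ g : G, (SimpleGraph.mulCayley S).Reachable 1 g := by
    intro g
    have hg : g ∈ Subgroup.closure S := hS ▸ Subgroup.mem_top g
    induction hg using Subgroup.closure_induction with
    | mem s hs =>
      by_cases h1 : s = 1
      · rw [h1]
      · refine SimpleGraph.Adj.reachable ?_
        rw [SimpleGraph.mulCayley_adj]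
        exact ⟨Ne.symm h1, Or.inl (by simpa using hs)⟩
    | one => exact SimpleGraph.Reachable.refl _
    | mul a b _ _ ha hb => exact ha.trans (by simpa using reachable_mulCayley_mul_left a hb)
    | inv a _ ha => simpa using (reachable_mulCayley_mul_left a⁻¹ ha).symm
  exact (SimpleGraph.connected_iff _).mpr ⟨fun a b => (key a).symm.trans (key b), ⟨1⟩⟩

theorem dist_mul_left (hS : Subgroup.closure S = ⊤) (g a b : G) :
    (SimpleGraph.mulCayley S).dist (g * a) (g * b) = (SimpleGraph.mulCayley S).dist a b := by
  have key : ∀ g a b : G, (SimpleGraph.mulCayley S).dist (g * a) (g * b) ≤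
      (SimpleGraph.mulCayley S).dist a b := by
    intro g a b
    obtain ⟨p, hp⟩ := (connected_mulCayley hS).exists_walk_length_eq_dist a b
    rw [← hp, ← p.length_map (⟨(g * ·), fun h => SimpleGraph.mulCayley_adj_mul_iff_right.mpr h⟩ :
      SimpleGraph.mulCayley S →g SimpleGraph.mulCayley S)]
    exact SimpleGraph.dist_le _
  refine (key g a b).antisymm ?_
  simpa using key g⁻¹ (g * a) (g * b)

/-- Word metrics for finite generating sets are Lipschitz equivalent. -/
theorem exists_dist_le_mul_dist (hS : IsFiniteGenSet S) (hS' : Subgroup.closure S' = ⊤) :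
    ∃ C : ℕ, ∀ a b : G,
      (SimpleGraph.mulCayley S').dist a b ≤ C * (SimpleGraph.mulCayley S).dist a b := by
  have hc := connected_mulCayley hS'
  refine ⟨∑ s ∈ hS.1.toFinset, (SimpleGraph.mulCayley S').dist 1 s, fun a b => ?_⟩
  set C := ∑ s ∈ hS.1.toFinset, (SimpleGraph.mulCayley S').dist 1 s
  have hgen : ∀ s ∈ S, (SimpleGraph.mulCayley S').dist 1 s ≤ C := fun s hs =>
    Finset.single_le_sum (f := fun s => (SimpleGraph.mulCayley S').dist 1 s)
      (fun _ _ => Nat.zero_le _) (hS.1.mem_toFinset.mpr hs)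
  have hadj : ∀ a b, (SimpleGraph.mulCayley S).Adj a b →
      (SimpleGraph.mulCayley S').dist a b ≤ C := by
    intro a b hab
    rw [SimpleGraph.mulCayley_adj] at hab
    rcases hab.2 with h | h
    · simpa [← dist_mul_left hS' a 1] using hgen _ h
    · rw [SimpleGraph.dist_comm]
      simpa [← dist_mul_left hS' b 1] using hgen _ h
  obtain ⟨p, hp⟩ := (connected_mulCayley hS.2).exists_walk_length_eq_dist a b
  rw [← hp]
  clear hp
  induction p with
  | nil => simp
  | cons h p ih =>
    refine hc.dist_triangle.trans ((Nat.add_le_add (hadj _ _ h) ih).trans ?_)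
    rw [SimpleGraph.Walk.length_cons]
    exact le_of_eq (by ring)

theorem finite_setOf_dist_le (hS : IsFiniteGenSet S) (n : ℕ) :
    {g : G | (SimpleGraph.mulCayley S).dist 1 g ≤ n}.Finite := by
  have hc := connected_mulCayley hS.2
  induction n with
  | zero =>
    refine (Set.finite_singleton (1 : G)).subset fun g hg => ?_
    exact (hc.dist_eq_zero_iff.mp (Nat.le_zero.mp hg)).symm
  | succ n ih =>
    refine (ih.union (Set.Finite.image2 (· * ·) ih (hS.1.union hS.1.inv))).subset fun g hg => ?_
    rcases Nat.lt_or_ge n ((SimpleGraph.mulCayley S).dist 1 g) with hlt | hle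
    · have hg : (SimpleGraph.mulCayley S).dist 1 g = n + 1 := le_antisymm hg hlt
      obtain ⟨γ, hγ0, hγ1, hγ⟩ := exists_isGeodesic hc 1 g
      rw [hg] at hγ hγ1
      have h1 := hγ 0 n (Nat.zero_le _) (Nat.le_succ _)
      have h2 := hγ n (n + 1) (Nat.le_succ _) le_rfl
      rw [hγ0] at h1
      rw [hγ1, Nat.add_sub_cancel_left, SimpleGraph.dist_eq_one_iff_adj,
        SimpleGraph.mulCayley_adj] at h2
      refine Or.inr ⟨γ n, h1.le, (γ n)⁻¹ * g, ?_, by simp⟩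
      rcases h2.2 with h | h
      · exact Or.inl h
      · exact Or.inr (by simpa using h)
    · exact Or.inl hle

end WordMetric

/-! ### Stable subgroups and their cosets -/

section Cosets

variable {G : Type*} [Group G] {S : Set G}

/-- Stability of a subgroup, stated in the word metric of an arbitrary finite generating set of the
ambient group. -/
theorem IsStable.exists_isUniformlyStable {H : Subgroup G} (hH : IsStable H)
    (hS : IsFiniteGenSet S) :
    ∃ (T : Set H) (Λ E : ℝ) (f : ℝ → ℝ → ℝ), Subgroup.closure T = ⊤ ∧ 1 ≤ Λ ∧ 0 ≤ E ∧
      (∀ K ε, 0 ≤ f K ε) ∧ IsUniformlyStable (SimpleGraph.mulCayley T) (SimpleGraph.mulCayley S)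
        (fun h : H => (h : G)) Λ E f := by
  obtain ⟨T, S₀, hT, hS₀, ⟨Λ, E, hΛ, hE, hqi⟩, f, hf⟩ := hH
  obtain ⟨C₁, hC₁⟩ := exists_dist_le_mul_dist hS hS₀.2
  obtain ⟨C₂, hC₂⟩ := exists_dist_le_mul_dist hS₀ hS.2
  set C : ℝ := 1 + C₁ + C₂ with hC
  have hC1 : 1 ≤ C := by
    linarith [Nat.cast_nonneg (α := ℝ) C₁, Nat.cast_nonneg (α := ℝ) C₂]
  have le₁ : ∀ a b : G, ((SimpleGraph.mulCayley S₀).dist a b : ℝ) ≤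
      C * (SimpleGraph.mulCayley S).dist a b := by
    intro a b
    have h1 : ((SimpleGraph.mulCayley S₀).dist a b : ℝ) ≤
      C₁ * (SimpleGraph.mulCayley S).dist a b := by exact_mod_cast hC₁ a b
    refine h1.trans ?_
    gcongr
    linarith [Nat.cast_nonneg (α := ℝ) C₂]
  have le₂ : ∀ a b : G, ((SimpleGraph.mulCayley S).dist a b : ℝ) ≤
      C * (SimpleGraph.mulCayley S₀).dist a b := by
    intro a b
    have h1 : ((SimpleGraph.mulCayley S).dist a b : ℝ) ≤
      C₂ * (SimpleGraph.mulCayley S₀).dist a b := by exact_mod_cast hC₂ a b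
    refine h1.trans ?_
    gcongr
    linarith [Nat.cast_nonneg (α := ℝ) C₁]
  refine ⟨T, C * Λ, C * E, fun K ε => max 0 (C * f (C * K) (C * ε)), hT.2,
    one_le_mul_of_one_le_of_one_le hC1 hΛ, by positivity, fun K ε => le_max_left _ _, ?_, ?_, ?_⟩
  · intro x y
    have h1 := (hqi x y).1
    rw [sub_le_iff_le_add, inv_mul_le_iff₀ (by linarith)] at h1
    have h2 := le₁ (x : G) y
    calc ((SimpleGraph.mulCayley T).dist x y : ℝ)
        ≤ Λ * ((SimpleGraph.mulCayley S₀).dist (x : G) y + E) := h1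
      _ ≤ Λ * (C * (SimpleGraph.mulCayley S).dist (x : G) y + C * (C * E)) := by
          gcongr
          have : E ≤ C * E := le_mul_of_one_le_left hE hC1
          nlinarith
      _ = C * Λ * ((SimpleGraph.mulCayley S).dist (x : G) y + C * E) := by ring
  · intro x y
    calc ((SimpleGraph.mulCayley S).dist (x : G) y : ℝ)
        ≤ C * (SimpleGraph.mulCayley S₀).dist (x : G) y := le₂ _ _
      _ ≤ C * (Λ * (SimpleGraph.mulCayley T).dist x y + E) := by
          gcongr
          exact (hqi x y).2
      _ = C * Λ * (SimpleGraph.mulCayley T).dist x y + C * E := by ring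
  · intro n γ hγ K ε hK hε m η hη h0 h1 j hj
    have hCK : 1 ≤ C * K := one_le_mul_of_one_le_of_one_le hC1 hK
    have hη' : IsQuasigeodesic (SimpleGraph.mulCayley S₀) (C * K) (C * ε) m η := by
      rw [isQuasigeodesic_iff hCK]
      rw [isQuasigeodesic_iff hK] at hη
      intro i k hik hk
      obtain ⟨h2, h3⟩ := hη i k hik hk
      constructor
      · calc (k : ℝ) - i ≤ K * ((SimpleGraph.mulCayley S).dist (η i) (η k) + ε) := h2
          _ ≤ K * (C * (SimpleGraph.mulCayley S₀).dist (η i) (η k) + C * (C * ε)) := by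
            gcongr
            · exact le₂ _ _
            · have : ε ≤ C * ε := le_mul_of_one_le_left hε hC1
              nlinarith
          _ = C * K * ((SimpleGraph.mulCayley S₀).dist (η i) (η k) + C * ε) := by ring
      · calc ((SimpleGraph.mulCayley S₀).dist (η i) (η k) : ℝ)
            ≤ C * (SimpleGraph.mulCayley S).dist (η i) (η k) := le₁ _ _
          _ ≤ C * (K * ((k : ℝ) - i) + ε) := by gcongr
          _ = C * K * ((k : ℝ) - i) + C * ε := by ring
    obtain ⟨i, hi, hd⟩ := hf n γ hγ (C * K) (C * ε) hCK (by positivity) m η hη' h0 h1 j hj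
    refine ⟨i, hi, (le₂ _ _).trans (le_max_of_le_right ?_)⟩
    gcongr

/-- Left translates of stable embeddings are stable embeddings. -/
theorem IsUniformlyStable.mul_left {V : Type*} {Γ : SimpleGraph V} {Φ : V → G} {Λ E : ℝ}
    {f : ℝ → ℝ → ℝ} (hS : Subgroup.closure S = ⊤)
    (h : IsUniformlyStable Γ (SimpleGraph.mulCayley S) Φ Λ E f) (g : G) :
    IsUniformlyStable Γ (SimpleGraph.mulCayley S) (fun v => g * Φ v) Λ E f where
  le_dist x y := by rw [dist_mul_left hS]; exact h.le_dist x y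
  dist_le x y := by rw [dist_mul_left hS]; exact h.dist_le x y
  stable n γ hγ K ε hK hε m η hη := by
    rintro ⟨i₀, hi₀, h0⟩ ⟨i₁, hi₁, h1⟩ j hj
    obtain ⟨i, hi, hd⟩ := h.stable n γ hγ K ε hK hε m (fun k => g⁻¹ * η k)
      (fun i k hi hk => by rw [dist_mul_left hS]; exact hη i k hi hk)
      ⟨i₀, hi₀, by simp [h0]⟩ ⟨i₁, hi₁, by simp [h1]⟩ j hj
    refine ⟨i, hi, ?_⟩
    rwa [← dist_mul_left hS g, mul_inv_cancel_left] at hd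

/-- The members of a finite family of stable subgroups, and hence all their cosets, are stable
with common constants. -/
theorem exists_forall_isUniformlyStable (hS : IsFiniteGenSet S) {l : ℕ} {H : Fin l → Subgroup G}
    (hH : ∀ i, IsStable (H i)) :
    ∃ (T : ∀ i, Set (H i)) (Λ E : ℝ) (f : ℝ → ℝ → ℝ), (∀ i, Subgroup.closure (T i) = ⊤) ∧ 1 ≤ Λ ∧
      0 ≤ E ∧ (∀ K ε, 0 ≤ f K ε) ∧ ∀ i (g : G),
        IsUniformlyStable (SimpleGraph.mulCayley (T i)) (SimpleGraph.mulCayley S)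
          (fun h : H i => g * (h : G)) Λ E f := by
  choose T Λ E f hT hΛ hE hf h using fun i => (hH i).exists_isUniformlyStable hS
  have hΛ0 : ∀ i, 0 ≤ Λ i := fun i => zero_le_one.trans (hΛ i)
  refine ⟨T, 1 + ∑ i, Λ i, ∑ i, E i, fun K ε => ∑ i, f i K ε, hT, ?_, ?_, ?_, ?_⟩
  · linarith [Finset.sum_nonneg fun i (_ : i ∈ Finset.univ) => hΛ0 i]
  · exact Finset.sum_nonneg fun i _ => hE i
  · exact fun K ε => Finset.sum_nonneg fun i _ => hf i K ε
  · intro i g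
    refine ((h i).mul_left hS.2 g).mono (hΛ0 i) (hE i) ?_ ?_ ?_
    · linarith [Finset.single_le_sum (fun i _ => hΛ0 i) (Finset.mem_univ i)]
    · exact Finset.single_le_sum (fun i _ => hE i) (Finset.mem_univ i)
    · exact fun K ε => Finset.single_le_sum (f := fun i => f i K ε) (fun i _ => hf i K ε)
        (Finset.mem_univ i)

theorem leftCoset_mul_mem (g : G) {H : Subgroup G} {h : G} (hh : h ∈ H) :
    leftCoset (g * h) H = leftCoset g H := by
  ext x
  constructor
  · rintro ⟨k, hk, rfl⟩
    exact ⟨h * k, H.mul_mem hh hk, mul_assoc _ _ _⟩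
  · rintro ⟨k, hk, rfl⟩
    exact ⟨h⁻¹ * k, H.mul_mem (H.inv_mem hh) hk, by group⟩

/-- Only boundedly many cosets of finitely many subgroups come close to a given point. -/
theorem exists_card_le_of_forall_dist_le (hS : IsFiniteGenSet S) {l : ℕ} (H : Fin l → Subgroup G)
    (C : ℝ) : ∃ M : ℕ, ∀ (k : ℕ) (σ : Fin k → Fin l) (g : Fin k → G),
      Function.Injective (fun j => leftCoset (g j) (H (σ j))) →
      (∃ p, ∀ j, ∃ h : H (σ j), ((SimpleGraph.mulCayley S).dist p (g j * h) : ℝ) ≤ C) →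
      k ≤ M := by
  obtain ⟨n, hn⟩ := exists_nat_ge C
  set B : Finset G := (finite_setOf_dist_le hS n).toFinset with hB
  refine ⟨l * B.card, fun k σ g hinj ⟨p, hp⟩ => ?_⟩
  choose h hh using hp
  have hmem : ∀ j, p⁻¹ * (g j * h j) ∈ B := by
    intro j
    rw [hB, Set.Finite.mem_toFinset, Set.mem_ofPred_eq, ← dist_mul_left hS.2 p, mul_one,
      mul_inv_cancel_left]
    exact_mod_cast (hh j).trans hn
  have hF : Set.InjOn (fun j => (σ j, p⁻¹ * (g j * h j))) (Finset.univ : Finset (Fin k)) := by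
    intro i _ j _ hij
    simp only [Prod.mk.injEq, mul_right_inj] at hij
    refine hinj ?_
    change leftCoset (g i) (H (σ i)) = leftCoset (g j) (H (σ j))
    rw [← leftCoset_mul_mem (g i) (h i).2, ← leftCoset_mul_mem (g j) (h j).2, hij.2, hij.1]
  have := Finset.card_le_card_of_injOn (t := Finset.univ ×ˢ B) _
    (fun j _ => by simpa using hmem j) hF
  simpa using this

theorem mem_conjugate_iff {H : Subgroup G} {g k : G} :
    k ∈ conjugate H g ↔ ∃ h ∈ H, k * g = g * h := by
  simp only [conjugate, Subgroup.mem_map, MulEquiv.coe_toMonoidHom, MulAut.conj_apply,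
    mul_inv_eq_iff_eq_mul, eq_comm (a := k * g)]

/-- If the intersection of the corresponding conjugates is infinite, then two cosets of stable
subgroups are uniformly close. -/
theorem exists_dist_le_of_infinite_inf (hS : IsFiniteGenSet S) {Λ E : ℝ} {f : ℝ → ℝ → ℝ}
    (hΛ : 1 ≤ Λ) (hE : 0 ≤ E) {H₁ H₂ : Subgroup G} {T₁ : Set H₁} {T₂ : Set H₂}
    (hT₁ : Subgroup.closure T₁ = ⊤) (hT₂ : Subgroup.closure T₂ = ⊤) {g₁ g₂ : G}
    (h₁ : IsUniformlyStable (SimpleGraph.mulCayley T₁) (SimpleGraph.mulCayley S)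
      (fun h : H₁ => g₁ * (h : G)) Λ E f)
    (h₂ : IsUniformlyStable (SimpleGraph.mulCayley T₂) (SimpleGraph.mulCayley S)
      (fun h : H₂ => g₂ * (h : G)) Λ E f)
    (hinf : Infinite (conjugate H₁ g₁ ⊓ conjugate H₂ g₂ : Subgroup G)) :
    ∃ (v : H₁) (w : H₂), ((SimpleGraph.mulCayley S).dist (g₁ * v) (g₂ * w) : ℝ) ≤ f (9 * Λ) E := by
  set Δ := SimpleGraph.mulCayley S with hΔ
  -- `x` is nearest to `g₂`; the elements `k` of the intersection translate this pair of points.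
  set x : H₁ := Function.argmin (fun v : H₁ => Δ.dist g₂ (g₁ * v))
  have hx : ∀ v : H₁, Δ.dist g₂ (g₁ * x) ≤ Δ.dist g₂ (g₁ * v) :=
    fun v => Function.argmin_le (fun v : H₁ => Δ.dist g₂ (g₁ * v)) v
  obtain ⟨k, ⟨hk₁, hk₂⟩, hk⟩ : ∃ k ∈ conjugate H₁ g₁ ⊓ conjugate H₂ g₂,
      3 * Δ.dist g₂ (g₁ * x) < Δ.dist (g₁ * x) (k * (g₁ * x)) := by
    by_contra! hcon
    refine hinf.not_finite (Set.Finite.to_subtype ?_)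
    refine ((finite_setOf_dist_le hS (3 * Δ.dist g₂ (g₁ * x))).image
      (fun a => g₁ * x * a * (g₁ * x)⁻¹)).subset fun k hk => ?_
    refine ⟨(g₁ * x)⁻¹ * (k * (g₁ * x)), ?_, by group⟩
    rw [Set.mem_ofPred_eq, ← dist_mul_left hS.2 (g₁ * x), mul_one, mul_inv_cancel_left]
    exact hcon k hk
  obtain ⟨a₁, ha₁, hk₁⟩ := mem_conjugate_iff.mp hk₁
  obtain ⟨a₂, ha₂, hk₂⟩ := mem_conjugate_iff.mp hk₂
  have hx' : g₁ * (a₁ * x) = k * (g₁ * x) := by rw [← mul_assoc, ← hk₁, mul_assoc]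
  obtain ⟨v, hv⟩ := exists_dist_le_of_long (connected_mulCayley hS.2) hΛ hE
    (connected_mulCayley hT₁) (connected_mulCayley hT₂) h₁ h₂ (x := x) (x' := ⟨a₁, ha₁⟩ * x)
    (y := 1) (y' := ⟨a₂, ha₂⟩) (R := Δ.dist g₂ (g₁ * x)) (by simpa using hx)
    (by
      intro v
      have hv : k * (g₁ * (a₁⁻¹ * v)) = g₁ * v := by
        rw [← mul_assoc, hk₁, mul_assoc, mul_inv_cancel_left]
      simp only [Subgroup.coe_mul, hx', ← hk₂, ← hv, ← hΔ]
      rw [hΔ, dist_mul_left hS.2, dist_mul_left hS.2]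
      exact hx (⟨a₁, ha₁⟩⁻¹ * v))
    (by simp [hΔ])
    (by simp only [Subgroup.coe_mul, hx', ← hk₂]; rw [dist_mul_left hS.2])
    (by simp only [Subgroup.coe_mul, hx']; exact hk.le)
  exact ⟨x, v, hv⟩

end Cosets

/-! ### Packing, width and height -/

section Packing

variable {G : Type*} [Group G] {S : Set G} {l : ℕ} {H : Fin l → Subgroup G}

/-- Boundedly many cosets of stable subgroups are pairwise close. -/
theorem exists_card_le_of_pairwise_dist_le (hS : IsFiniteGenSet S) {T : ∀ i, Set (H i)} {Λ E : ℝ}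
    {f : ℝ → ℝ → ℝ} (hT : ∀ i, Subgroup.closure (T i) = ⊤) (hΛ : 1 ≤ Λ) (hE : 0 ≤ E)
    (hf : ∀ K ε, 0 ≤ f K ε)
    (h : ∀ i (g : G), IsUniformlyStable (SimpleGraph.mulCayley (T i)) (SimpleGraph.mulCayley S)
      (fun h : H i => g * (h : G)) Λ E f) {D : ℝ} (hD : 0 ≤ D) :
    ∃ M : ℕ, ∀ (k : ℕ) (σ : Fin k → Fin l) (g : Fin k → G),
      Function.Injective (fun j => leftCoset (g j) (H (σ j))) →
      (∀ i j, i ≠ j → ∃ (v : H (σ i)) (w : H (σ j)),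
        ((SimpleGraph.mulCayley S).dist (g i * v) (g j * w) : ℝ) ≤ D) →
      k ≤ M := by
  obtain ⟨M, hM⟩ := exists_card_le_of_forall_dist_le hS H (hellyConst Λ E f D)
  refine ⟨M, fun k σ g hinj hclose => ?_⟩
  rcases Nat.eq_zero_or_pos k with rfl | hk
  · exact Nat.zero_le _
  have : Nonempty (Fin k) := ⟨⟨0, hk⟩⟩
  refine hM k σ g hinj ?_
  refine exists_forall_dist_le (connected_mulCayley hS.2) hΛ hE hf hD
    (fun j => connected_mulCayley (hT (σ j))) (fun j => h (σ j) (g j)) fun i j => ?_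
  rcases eq_or_ne i j with rfl | hij
  · exact ⟨1, 1, by simpa using hD⟩
  · exact hclose i j hij

theorem hasBoundedPacking_of_isStable (hS : IsFiniteGenSet S) (hH : ∀ i, IsStable (H i)) :
    HasBoundedPacking S H := by
  obtain ⟨T, Λ, E, f, hT, hΛ, hE, hf, h⟩ := exists_forall_isUniformlyStable hS hH
  intro D hD
  obtain ⟨M, hM⟩ := exists_card_le_of_pairwise_dist_le hS hT hΛ hE hf h hD
  refine ⟨M + 1, fun σ g hinj => ?_⟩
  by_contra! hcon
  refine (Nat.lt_succ_self M).not_ge (hM _ σ g hinj fun i j hij => ?_)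
  obtain ⟨_, ⟨v, hv, rfl⟩, _, ⟨w, hw, rfl⟩, hlt⟩ := hcon i j hij
  exact ⟨⟨v, hv⟩, ⟨w, hw⟩, hlt.le⟩

theorem exists_widthAtMost_of_isStable (hS : IsFiniteGenSet S) (hH : ∀ i, IsStable (H i)) :
    ∃ n, WidthAtMost H n := by
  obtain ⟨T, Λ, E, f, hT, hΛ, hE, hf, h⟩ := exists_forall_isUniformlyStable hS hH
  obtain ⟨M, hM⟩ := exists_card_le_of_pairwise_dist_le hS hT hΛ hE hf h (hf (9 * Λ) E)
  exact ⟨M, fun k σ g hinj hinf => hM k σ g hinj fun i j _ =>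
    exists_dist_le_of_infinite_inf hS hΛ hE (hT _) (hT _) (h _ _) (h _ _) (hinf i j)⟩

theorem WidthAtMost.heightAtMost {n : ℕ} (h : WidthAtMost H n) : HeightAtMost H n := by
  intro σ g hinj
  by_contra hfin
  rw [not_finite_iff_infinite] at hfin
  refine (Nat.lt_succ_self n).not_ge (h _ σ g hinj fun i j => ?_)
  exact Infinite.of_injective _ (Subgroup.inclusion_injective
    (le_inf (iInf_le (fun j => conjugate (H (σ j)) (g j)) i)
      (iInf_le (fun j => conjugate (H (σ j)) (g j)) j)))

end Packing

end StableSubgroups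

theorem theorem1p1 {G : Type*} [Group G] [Group.FG G] {l : ℕ} (H : Fin l → Subgroup G)
    (hH : ∀ i, StableSubgroups.IsStable (H i)) :
    (∃ n : ℕ, StableSubgroups.HeightAtMost H n) ∧
    (∃ n : ℕ, StableSubgroups.WidthAtMost H n) ∧
    (∀ S : Set G, StableSubgroups.IsFiniteGenSet S → StableSubgroups.HasBoundedPacking S H) := by
  obtain ⟨S, hS, hfin⟩ := Group.fg_iff.mp ‹Group.FG G›
  obtain ⟨n, hn⟩ := StableSubgroups.exists_widthAtMost_of_isStable ⟨hfin, hS⟩ hH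
  exact ⟨⟨n, hn.heightAtMost⟩, ⟨n, hn⟩, fun S hS =>
    StableSubgroups.hasBoundedPacking_of_isStable hS hH⟩
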